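/- Let $\varepsilon_1,\varepsilon_2\in\mathbb R$, let $N$ be a non-negative integer, and let $p_i,\xi_{i0},C_i,D_i\in\mathbb C$ ($1\le i\le N$) be parameters with $p_i+p_j^*\neq 0$ for all $i,j$, where $^*$ denotes complex conjugation. For $(x,t)\in\mathbb R^2$ put $\xi_i=p_ix+p_i^3t+\xi_{i0}$, let $M=(m_{ij})$ be the $N\times N$ matrix with $$m_{ij}=\frac{1}{p_i+p_j^*}\left(e^{\xi_i+\xi_j^*}-\varepsilon_1C_i^*C_j-\varepsilon_2D_i^*D_j\right),$$ let $\Phi=(e^{\xi_1},\dots,e^{\xi_N})^T$, $\bar\Psi=(C_1,\dots,C_N)^T$, $\bar\Upsilon=(D_1,\dots,D_N)^T$, and set $$f=|M|,\qquad g_1=\begin{vmatrix}M&\Phi\\-\bar\Psi^T&0\end{vmatrix},\qquad g_2=\begin{vmatrix}M&\Phi\\-\bar\Upsilon^T&0\end{vmatrix}.$$ Then the set $\{(x,t)\in\mathbb R^2: f(x,t)\ne0\}$ is open, and on it $u_1=g_1/f$ and $u_2=g_2/f$ are smooth and satisfy the coupled Hirota system $$u_{1,t}=u_{1,xxx}-3(\varepsilon_1|u_1|^2+\varepsilon_2|u_2|^2)u_{1,x}-3u_1(\varepsilon_1u_1^*u_{1,x}+\varepsilon_2u_2^*u_{2,x}),$$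 $$u_{2,t}=u_{2,xxx}-3(\varepsilon_1|u_1|^2+\varepsilon_2|u_2|^2)u_{2,x}-3u_2(\varepsilon_1u_1^*u_{1,x}+\varepsilon_2u_2^*u_{2,x}).$$ Moreover, these solutions are bright (they satisfy the zero boundary condition) for nondegenerate parameters: if the $p_i$ are distinct and the principal minors of the matrix $\left(\frac{-\varepsilon_1C_i^*C_j-\varepsilon_2D_i^*D_j}{p_i+p_j^*}\right)_{i,j}$ over the index sets $\{i:\operatorname{Re}p_i>0\}$ and $\{i:\operatorname{Re}p_i<0\}$ are nonzero (an empty minor being $1$), then for every $t\in\mathbb R$ we have $f(x,t)\neq0$ for all sufficiently large $|x|$, and $u_1(x,t)\to0$ and $u_2(x,t)\to0$ as $x\to\pm\infty$. -/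

import Mathlib

open scoped ComplexConjugate ContDiff

namespace CHirota

noncomputable section

/-- `(u₁, u₂)` is a smooth classical solution, on the open set `S` of points `(x, t)`, of the
coupled Hirota system
`u₁_t = u₁_xxx - 3 (ε₁|u₁|² + ε₂|u₂|²) u₁_x - 3 u₁ (ε₁ u₁^* u₁_x + ε₂ u₂^* u₂_x)`,
`u₂_t = u₂_xxx - 3 (ε₁|u₁|² + ε₂|u₂|²) u₂_x - 3 u₂ (ε₁ u₁^* u₁_x + ε₂ u₂^* u₂_x)`. -/
structure IsSolutionOn (ε₁ ε₂ : ℝ) (u₁ u₂ : ℝ → ℝ → ℂ) (S : Set (ℝ × ℝ)) : Prop where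
  isOpen : IsOpen S
  smooth₁ : ContDiffOn ℝ ∞ (fun z : ℝ × ℝ => u₁ z.1 z.2) S
  smooth₂ : ContDiffOn ℝ ∞ (fun z : ℝ × ℝ => u₂ z.1 z.2) S
  eq₁ : ∀ x t : ℝ, (x, t) ∈ S →
    deriv (fun s => u₁ x s) t =
      iteratedDeriv 3 (fun y => u₁ y t) x
        - 3 * ((ε₁ : ℂ) * ((‖u₁ x t‖ ^ 2 : ℝ) : ℂ) + (ε₂ : ℂ) * ((‖u₂ x t‖ ^ 2 : ℝ) : ℂ))
          * deriv (fun y => u₁ y t) x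
        - 3 * u₁ x t * ((ε₁ : ℂ) * conj (u₁ x t) * deriv (fun y => u₁ y t) x
          + (ε₂ : ℂ) * conj (u₂ x t) * deriv (fun y => u₂ y t) x)
  eq₂ : ∀ x t : ℝ, (x, t) ∈ S →
    deriv (fun s => u₂ x s) t =
      iteratedDeriv 3 (fun y => u₂ y t) x
        - 3 * ((ε₁ : ℂ) * ((‖u₁ x t‖ ^ 2 : ℝ) : ℂ) + (ε₂ : ℂ) * ((‖u₂ x t‖ ^ 2 : ℝ) : ℂ))
          * deriv (fun y => u₂ y t) x
        - 3 * u₂ x t * ((ε₁ : ℂ) * conj (u₁ x t) * deriv (fun y => u₁ y t) x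
          + (ε₂ : ℂ) * conj (u₂ x t) * deriv (fun y => u₂ y t) x)

variable {N : ℕ}

/-- The phase `ξ_i = p_i x + p_i³ t + ξ_{i0}`. -/
def phase (p ξ₀ : Fin N → ℂ) (x t : ℝ) (i : Fin N) : ℂ :=
  p i * (x : ℂ) + p i ^ 3 * (t : ℂ) + ξ₀ i

/-- The matrix `m_ij = (p_i + p_j^*)⁻¹ (exp (ξ_i + ξ_j^*) - ε₁ C_i^* C_j - ε₂ D_i^* D_j)`. -/
def M (ε₁ ε₂ : ℝ) (p ξ₀ C D : Fin N → ℂ) (x t : ℝ) : Matrix (Fin N) (Fin N) ℂ :=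
  Matrix.of fun i j =>
    1 / (p i + conj (p j)) *
      (Complex.exp (phase p ξ₀ x t i + conj (phase p ξ₀ x t j))
        - (ε₁ : ℂ) * conj (C i) * C j - (ε₂ : ℂ) * conj (D i) * D j)

/-- The column `Φ = (exp ξ_1, …, exp ξ_N)ᵀ`. -/
def Phi (p ξ₀ : Fin N → ℂ) (x t : ℝ) : Fin N → ℂ :=
  fun i => Complex.exp (phase p ξ₀ x t i)

/-- The bordered determinant with blocks `A`, column `a`, row `-bᵀ` and corner `0`. -/
def borderedDet (A : Matrix (Fin N) (Fin N) ℂ) (a b : Fin N → ℂ) : ℂ :=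
  (Matrix.fromBlocks A (Matrix.replicateCol Unit a) (Matrix.replicateRow Unit (-b)) 0).det

/-- `f = |M|`. -/
def f (ε₁ ε₂ : ℝ) (p ξ₀ C D : Fin N → ℂ) (x t : ℝ) : ℂ :=
  (M ε₁ ε₂ p ξ₀ C D x t).det

/-- `g₁`: the determinant of `M` bordered by `Φ` and `-(C_1, …, C_N)`. -/
def g₁ (ε₁ ε₂ : ℝ) (p ξ₀ C D : Fin N → ℂ) (x t : ℝ) : ℂ :=
  borderedDet (M ε₁ ε₂ p ξ₀ C D x t) (Phi p ξ₀ x t) C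

/-- `g₂`: the determinant of `M` bordered by `Φ` and `-(D_1, …, D_N)`. -/
def g₂ (ε₁ ε₂ : ℝ) (p ξ₀ C D : Fin N → ℂ) (x t : ℝ) : ℂ :=
  borderedDet (M ε₁ ε₂ p ξ₀ C D x t) (Phi p ξ₀ x t) D

/-- `u₁ = g₁ / f`. -/
def u₁ (ε₁ ε₂ : ℝ) (p ξ₀ C D : Fin N → ℂ) (x t : ℝ) : ℂ :=
  g₁ ε₁ ε₂ p ξ₀ C D x t / f ε₁ ε₂ p ξ₀ C D x t

/-- `u₂ = g₂ / f`. -/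
def u₂ (ε₁ ε₂ : ℝ) (p ξ₀ C D : Fin N → ℂ) (x t : ℝ) : ℂ :=
  g₂ ε₁ ε₂ p ξ₀ C D x t / f ε₁ ε₂ p ξ₀ C D x t

/-- The constant part `k_ij = (p_i + p_j^*)⁻¹ (-ε₁ C_i^* C_j - ε₂ D_i^* D_j)` of `M`. -/
def K (ε₁ ε₂ : ℝ) (p C D : Fin N → ℂ) : Matrix (Fin N) (Fin N) ℂ :=
  Matrix.of fun i j =>
    1 / (p i + conj (p j)) *
      (-(ε₁ : ℂ) * conj (C i) * C j - (ε₂ : ℂ) * conj (D i) * D j)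

/-- The parameters are nondegenerate: the `p_i` are distinct, and the principal minors of the
constant matrix `K` over `{i | 0 < Re p_i}` and over `{i | Re p_i < 0}` do not vanish (an empty
minor is `1`).  For `N = 1` this says `ε₁ |C_1|² + ε₂ |D_1|² ≠ 0`. -/
def Nondegenerate (ε₁ ε₂ : ℝ) (p C D : Fin N → ℂ) : Prop :=
  Function.Injective p ∧
  ((K ε₁ ε₂ p C D).submatrix (fun i : {i : Fin N // 0 < (p i).re} => i.1)
    (fun i : {i : Fin N // 0 < (p i).re} => i.1)).det ≠ 0 ∧
  ((K ε₁ ε₂ p C D).submatrix (fun i : {i : Fin N // (p i).re < 0} => i.1)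
    (fun i : {i : Fin N // (p i).re < 0} => i.1)).det ≠ 0

/-- Zero boundary condition at time `t` for the quotients `u₁ = g₁ / f` and `u₂ = g₂ / f`: the
denominator does not vanish for large `|x|`, and both components tend to `0` as `x → ±∞`. -/
def ZeroBoundaryAt (ε₁ ε₂ : ℝ) (p ξ₀ C D : Fin N → ℂ) (t : ℝ) : Prop :=
  ∀ l ∈ ({Filter.atTop, Filter.atBot} : Set (Filter ℝ)),
    (∀ᶠ x in l, f ε₁ ε₂ p ξ₀ C D x t ≠ 0) ∧
    Filter.Tendsto (fun x => u₁ ε₁ ε₂ p ξ₀ C D x t) l (nhds 0) ∧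
    Filter.Tendsto (fun x => u₂ ε₁ ε₂ p ξ₀ C D x t) l (nhds 0)

end

end CHirota

/-! By a Schur complement, each `u_k` is a bilinear form `cᵀ M⁻¹ Φ` with `c = C` or `c = D`. The
factor `1/(p_i + p_j^*)` makes `∂ₓM` the rank-one matrix `ΦΦ^†` and `∂ₜM` a sum of three rank-one
matrices, so derivatives of such forms are polynomials in forms of the same kind
(`hasDerivAt_colPot_x`, `hasDerivAt_colPot_t`). The Sylvester equation `diagonal_mul_M_add` for `M`
yields the quadratic relations `wavePot_succ`, through which `ε₁` and `ε₂` enter; modulo these the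
PDE is a polynomial identity (`deriv_colPot_t`).

For the boundary condition, dividing out the growing exponentials makes `M` converge to a block
matrix: a Cauchy block on the growing indices, a block of `K` on the decaying ones. It is invertible
by nondegeneracy, and in the limit `cᵀ M⁻¹ Φ` pairs vectors supported on complementary blocks, hence
vanishes (`tendsto_colPot_zero`). -/

/-! ### Calculus of inverse matrices, and Cauchy determinants. -/

section MatrixCalculus

open Matrix

variable {n : Type*} [Fintype n]

theorem dotProduct_mul_vecMulVec_mul_mulVec (G : Matrix n n ℂ) (a b φ ψ : n → ℂ) :
    a ⬝ᵥ (G * vecMulVec φ ψ * G) *ᵥ b = (a ⬝ᵥ G *ᵥ φ) * (ψ ⬝ᵥ G *ᵥ b) := by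
  rw [← mulVec_mulVec, ← mulVec_mulVec, vecMulVec_mulVec, mulVec_smul, dotProduct_smul]
  simp

variable [DecidableEq n]

theorem contDiff_matrix_det {E : Type*} [NormedAddCommGroup E] [NormedSpace ℝ E] {k : WithTop ℕ∞}
    {A : E → Matrix n n ℂ} (hA : ∀ i j, ContDiff ℝ k fun z => A z i j) :
    ContDiff ℝ k fun z => (A z).det := by
  simp only [det_apply']
  exact ContDiff.sum fun σ _ => contDiff_const.mul (contDiff_prod fun i _ => hA _ _)

theorem differentiableAt_matrix_det {A : ℝ → Matrix n n ℂ} {s : ℝ}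
    (hA : ∀ i j, DifferentiableAt ℝ (fun r => A r i j) s) :
    DifferentiableAt ℝ (fun r => (A r).det) s := by
  simp only [det_apply']
  exact DifferentiableAt.fun_sum fun σ _ =>
    (differentiableAt_const _).mul (DifferentiableAt.fun_finsetProd fun i _ => hA _ _)

theorem differentiableAt_matrix_inv {A : ℝ → Matrix n n ℂ} {s : ℝ}
    (hA : ∀ i j, DifferentiableAt ℝ (fun r => A r i j) s) (hs : (A s).det ≠ 0) (i j : n) :
    DifferentiableAt ℝ (fun r => (A r)⁻¹ i j) s := by
  have hadj : DifferentiableAt ℝ (fun r => (A r).adjugate i j) s := by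
    simp only [adjugate_apply]
    refine differentiableAt_matrix_det fun k l => ?_
    simp only [updateRow_apply]
    split_ifs
    · exact differentiableAt_const _
    · exact hA k l
  have : (fun r => (A r)⁻¹ i j) = fun r => (A r).det⁻¹ * (A r).adjugate i j := by
    ext r
    simp [inv_def]
  rw [this]
  exact ((differentiableAt_matrix_det hA).inv hs).mul hadj

/-- Differentiate `A⁻¹ A = 1`; differentiability of the inverse is known beforehand from the
adjugate formula. -/
theorem hasDerivAt_matrix_inv {A : ℝ → Matrix n n ℂ} {A' : Matrix n n ℂ} {s : ℝ}
    (hA : ∀ i j, HasDerivAt (fun r => A r i j) (A' i j) s) (hs : (A s).det ≠ 0) (i j : n) :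
    HasDerivAt (fun r => (A r)⁻¹ i j) (-((A s)⁻¹ * A' * (A s)⁻¹) i j) s := by
  have hd := differentiableAt_matrix_inv (fun i j => (hA i j).differentiableAt) hs
  set G' : Matrix n n ℂ := of fun i j => deriv (fun r => (A r)⁻¹ i j) s with hG'
  have hG : ∀ i j, HasDerivAt (fun r => (A r)⁻¹ i j) (G' i j) s := fun i j => (hd i j).hasDerivAt
  have hne : ∀ᶠ r in nhds s, (A r).det ≠ 0 :=
    (differentiableAt_matrix_det fun i j =>
      (hA i j).differentiableAt).continuousAt.eventually_ne hs
  have key : G' * A s + (A s)⁻¹ * A' = 0 := by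
    ext i j
    have h1 : HasDerivAt (fun r => ∑ k, (A r)⁻¹ i k * A r k j)
        (∑ k, (G' i k * A s k j + (A s)⁻¹ i k * A' k j)) s :=
      HasDerivAt.fun_sum fun k _ => (hG i k).mul (hA k j)
    have h2 : (fun r => ∑ k, (A r)⁻¹ i k * A r k j) =ᶠ[nhds s]
        fun _ => (1 : Matrix n n ℂ) i j := by
      filter_upwards [hne] with r hr
      rw [← nonsing_inv_mul (A r) (isUnit_iff_ne_zero.2 hr), mul_apply]
    have h3 := (h1.congr_of_eventuallyEq h2.symm).unique (hasDerivAt_const s _)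
    simpa [mul_apply, Finset.sum_add_distrib] using h3
  have : G' = -((A s)⁻¹ * A' * (A s)⁻¹) := by
    have h := congrArg (· * (A s)⁻¹) key
    simp only [add_mul, zero_mul, Matrix.mul_assoc,
      mul_nonsing_inv (A s) (isUnit_iff_ne_zero.2 hs), Matrix.mul_one] at h
    rw [Matrix.mul_assoc]
    exact eq_neg_of_add_eq_zero_left h
  rw [← Matrix.neg_apply, ← this]
  exact hG i j

theorem hasDerivAt_dotProduct_inv_mulVec {A : ℝ → Matrix n n ℂ} {A' : Matrix n n ℂ}
    {a b : ℝ → n → ℂ} {a' b' : n → ℂ} {s : ℝ}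
    (hA : ∀ i j, HasDerivAt (fun r => A r i j) (A' i j) s) (hs : (A s).det ≠ 0)
    (ha : ∀ i, HasDerivAt (fun r => a r i) (a' i) s)
    (hb : ∀ i, HasDerivAt (fun r => b r i) (b' i) s) :
    HasDerivAt (fun r => a r ⬝ᵥ (A r)⁻¹ *ᵥ b r)
      (a' ⬝ᵥ (A s)⁻¹ *ᵥ b s + a s ⬝ᵥ (A s)⁻¹ *ᵥ b'
        - a s ⬝ᵥ ((A s)⁻¹ * A' * (A s)⁻¹) *ᵥ b s) s := by
  have h : HasDerivAt (fun r => ∑ i, a r i * ∑ j, (A r)⁻¹ i j * b r j)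
      (∑ i, (a' i * ∑ j, (A s)⁻¹ i j * b s j + a s i * ∑ j,
        (-((A s)⁻¹ * A' * (A s)⁻¹) i j * b s j + (A s)⁻¹ i j * b' j))) s :=
    HasDerivAt.fun_sum fun i _ => (ha i).mul
      (HasDerivAt.fun_sum fun j _ => (hasDerivAt_matrix_inv hA hs i j).mul (hb j))
  refine h.congr_deriv ?_
  simp only [dotProduct, mulVec, ← Finset.sum_add_distrib, ← Finset.sum_sub_distrib]
  refine Finset.sum_congr rfl fun i _ => ?_
  simp only [Finset.sum_add_distrib, neg_mul, Finset.sum_neg_distrib]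
  ring

/-- A kernel vector `y` gives the polynomial `∑ y_j ∏_{k≠j} (X + r_k)` of degree below `n`, which
vanishes at the `n` distinct points `q_i` and so is zero. Its value at `-r_j` isolates `y_j`. -/
theorem det_cauchy_ne_zero {q r : n → ℂ} (hq : Function.Injective q) (hr : Function.Injective r)
    (h : ∀ i j, q i + r j ≠ 0) : (of fun i j => 1 / (q i + r j)).det ≠ 0 := by
  classical
  intro h0
  obtain ⟨y, hy0, hy⟩ := exists_mulVec_eq_zero_iff.2 h0
  let R : Polynomial ℂ := ∑ j, Polynomial.C (y j) *
    ∏ k ∈ Finset.univ.erase j, (Polynomial.X + Polynomial.C (r k))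
  have hR (z : ℂ) : R.eval z = ∑ j, y j * ∏ k ∈ Finset.univ.erase j, (z + r k) := by
    simp [R, Polynomial.eval_finsetSum, Polynomial.eval_prod]
  have hroot (i : n) : R.eval (q i) = 0 := by
    have h1 : R.eval (q i) = (∏ k, (q i + r k)) * ∑ j, 1 / (q i + r j) * y j := by
      rw [hR, Finset.mul_sum]
      refine Finset.sum_congr rfl fun j _ => ?_
      rw [← Finset.mul_prod_erase _ _ (Finset.mem_univ j)]
      field_simp [h i j]
    have h2 := congrFun hy i
    simp only [mulVec, dotProduct, of_apply, Pi.zero_apply] at h2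
    rw [h1, h2, mul_zero]
  obtain ⟨j, hj⟩ := Function.ne_iff.1 hy0
  have hdeg : R.natDegree < Fintype.card n := by
    have hpos : 0 < Fintype.card n := Fintype.card_pos_iff.2 ⟨j⟩
    refine lt_of_le_of_lt (Polynomial.natDegree_sum_le_of_forall_le (n := Fintype.card n - 1) _ _
      fun k _ => ?_) (Nat.sub_lt hpos one_pos)
    refine (Polynomial.natDegree_C_mul_le _ _).trans ((Polynomial.natDegree_prod_le _ _).trans ?_)
    simp
  have hzero : R = 0 := Polynomial.eq_zero_of_natDegree_lt_card_of_eval_eq_zero R hq hroot hdeg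
  have h1 := hR (-r j)
  rw [hzero, Polynomial.eval_zero, Finset.sum_eq_single j] at h1
  · refine mul_ne_zero hj (Finset.prod_ne_zero_iff.2 fun k hk => ?_) h1.symm
    rw [neg_add_eq_sub, sub_ne_zero]
    exact fun he => (Finset.ne_of_mem_erase hk) (hr he)
  · intro k _ hk
    rw [Finset.prod_eq_zero (Finset.mem_erase.2 ⟨hk.symm, Finset.mem_univ j⟩) (by simp), mul_zero]
  · simp

end MatrixCalculus

/-! ### Smoothness, derivatives and the Sylvester equation of `M`. -/

namespace CHirota

open Matrix

variable {N : ℕ}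

theorem borderedDet_eq (A : Matrix (Fin N) (Fin N) ℂ) (a b : Fin N → ℂ) (hA : A.det ≠ 0) :
    borderedDet A a b = A.det * (b ⬝ᵥ A⁻¹ *ᵥ a) := by
  have : Invertible A := invertibleOfIsUnitDet A (isUnit_iff_ne_zero.2 hA)
  rw [borderedDet, det_fromBlocks₁₁, det_unique (n := Unit), invOf_eq_nonsing_inv, Matrix.mul_assoc]
  simp [Matrix.mul_apply, mulVec, dotProduct]

theorem contDiff_phase (p ξ₀ : Fin N → ℂ) (i : Fin N) :
    ContDiff ℝ ∞ fun z : ℝ × ℝ => phase p ξ₀ z.1 z.2 i := by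
  have h : ContDiff ℝ ∞ fun r : ℝ => (r : ℂ) := Complex.ofRealCLM.contDiff
  exact ((contDiff_const.mul (h.comp contDiff_fst)).add
    (contDiff_const.mul (h.comp contDiff_snd))).add contDiff_const

theorem contDiff_M (ε₁ ε₂ : ℝ) (p ξ₀ C D : Fin N → ℂ) (i j : Fin N) :
    ContDiff ℝ ∞ fun z : ℝ × ℝ => M ε₁ ε₂ p ξ₀ C D z.1 z.2 i j := by
  have h : ContDiff ℝ ∞ fun z : ℂ => conj z := Complex.conjCLE.contDiff
  simp only [M, of_apply]
  exact contDiff_const.mul ((((contDiff_phase p ξ₀ i).add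
    (h.comp (contDiff_phase p ξ₀ j))).cexp.sub contDiff_const).sub contDiff_const)

theorem contDiff_f (ε₁ ε₂ : ℝ) (p ξ₀ C D : Fin N → ℂ) :
    ContDiff ℝ ∞ fun z : ℝ × ℝ => f ε₁ ε₂ p ξ₀ C D z.1 z.2 :=
  contDiff_matrix_det (contDiff_M ε₁ ε₂ p ξ₀ C D)

theorem contDiff_borderedDet (ε₁ ε₂ : ℝ) (p ξ₀ C D c : Fin N → ℂ) :
    ContDiff ℝ ∞ fun z : ℝ × ℝ =>
      borderedDet (M ε₁ ε₂ p ξ₀ C D z.1 z.2) (Phi p ξ₀ z.1 z.2) c := by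
  refine contDiff_matrix_det fun i j => ?_
  rcases i with i | i <;> rcases j with j | j
  · exact contDiff_M ε₁ ε₂ p ξ₀ C D i j
  · exact (contDiff_phase p ξ₀ i).cexp
  · exact contDiff_const
  · exact contDiff_const

/-- The column `(p_i ^ m exp ξ_i)`, the `m`-th `x`-derivative of `Φ`. -/
noncomputable def waveCol (p ξ₀ : Fin N → ℂ) (m : ℕ) (x t : ℝ) : Fin N → ℂ :=
  fun i => p i ^ m * Complex.exp (phase p ξ₀ x t i)

/-- The entrywise complex conjugate of `waveCol`. -/
noncomputable def waveRow (p ξ₀ : Fin N → ℂ) (m : ℕ) (x t : ℝ) : Fin N → ℂ :=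
  fun i => conj (p i) ^ m * Complex.exp (conj (phase p ξ₀ x t i))

theorem waveCol_zero (p ξ₀ : Fin N → ℂ) (x t : ℝ) : waveCol p ξ₀ 0 x t = Phi p ξ₀ x t := by
  ext i
  simp [waveCol, Phi]

theorem star_waveCol (p ξ₀ : Fin N → ℂ) (m : ℕ) (x t : ℝ) :
    star (waveCol p ξ₀ m x t) = waveRow p ξ₀ m x t := by
  ext i
  simp [waveCol, waveRow, ← Complex.exp_conj]

theorem waveCol_succ (p ξ₀ : Fin N → ℂ) (m : ℕ) (x t : ℝ) :
    waveCol p ξ₀ (m + 1) x t = diagonal p *ᵥ waveCol p ξ₀ m x t := by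
  ext i
  simp only [waveCol, mulVec_diagonal]
  ring

theorem waveRow_succ (p ξ₀ : Fin N → ℂ) (m : ℕ) (x t : ℝ) :
    waveRow p ξ₀ (m + 1) x t = waveRow p ξ₀ m x t ᵥ* diagonal (star p) := by
  ext i
  simp only [waveRow, vecMul_diagonal, Pi.star_apply, RCLike.star_def]
  ring

theorem hasDerivAt_phase_x (p ξ₀ : Fin N → ℂ) (x t : ℝ) (i : Fin N) :
    HasDerivAt (fun y => phase p ξ₀ y t i) (p i) x := by
  simpa [phase] using
    ((Complex.ofRealCLM.hasDerivAt (x := x)).const_mul (p i)).add_const (p i ^ 3 * t + ξ₀ i)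

theorem hasDerivAt_phase_t (p ξ₀ : Fin N → ℂ) (x t : ℝ) (i : Fin N) :
    HasDerivAt (fun s => phase p ξ₀ x s i) (p i ^ 3) t := by
  simpa [phase] using
    (((Complex.ofRealCLM.hasDerivAt (x := t)).const_mul (p i ^ 3)).const_add
      (p i * x)).add_const (ξ₀ i)

theorem hasDerivAt_waveCol_x (p ξ₀ : Fin N → ℂ) (m : ℕ) (x t : ℝ) (i : Fin N) :
    HasDerivAt (fun y => waveCol p ξ₀ m y t i) (waveCol p ξ₀ (m + 1) x t i) x :=
  ((hasDerivAt_phase_x p ξ₀ x t i).cexp.const_mul _).congr_deriv (by simp only [waveCol]; ring)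

theorem hasDerivAt_waveCol_t (p ξ₀ : Fin N → ℂ) (m : ℕ) (x t : ℝ) (i : Fin N) :
    HasDerivAt (fun s => waveCol p ξ₀ m x s i) (waveCol p ξ₀ (m + 3) x t i) t :=
  ((hasDerivAt_phase_t p ξ₀ x t i).cexp.const_mul _).congr_deriv (by simp only [waveCol]; ring)

theorem hasDerivAt_waveRow_x (p ξ₀ : Fin N → ℂ) (m : ℕ) (x t : ℝ) (i : Fin N) :
    HasDerivAt (fun y => waveRow p ξ₀ m y t i) (waveRow p ξ₀ (m + 1) x t i) x :=
  ((hasDerivAt_phase_x p ξ₀ x t i).star.cexp.const_mul _).congr_deriv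
    (by simp only [waveRow, RCLike.star_def]; ring)

theorem hasDerivAt_M_x (ε₁ ε₂ : ℝ) (p ξ₀ C D : Fin N → ℂ)
    (hp : ∀ i j, p i + conj (p j) ≠ 0) (x t : ℝ) (i j : Fin N) :
    HasDerivAt (fun y => M ε₁ ε₂ p ξ₀ C D y t i j)
      (vecMulVec (waveCol p ξ₀ 0 x t) (waveRow p ξ₀ 0 x t) i j) x := by
  refine (((((hasDerivAt_phase_x p ξ₀ x t i).add
    (hasDerivAt_phase_x p ξ₀ x t j).star).cexp.sub_const _).sub_const _).const_mul
      _).congr_deriv ?_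
  simp only [vecMulVec_apply, waveCol, waveRow, pow_zero, one_mul, ← Complex.exp_add,
    RCLike.star_def]
  field_simp [hp i j]
  rfl

/-- The three terms come from `a³ + b³ = (a + b)(a² - ab + b²)` with `a = p_i`, `b = p_j^*`. -/
theorem hasDerivAt_M_t (ε₁ ε₂ : ℝ) (p ξ₀ C D : Fin N → ℂ)
    (hp : ∀ i j, p i + conj (p j) ≠ 0) (x t : ℝ) (i j : Fin N) :
    HasDerivAt (fun s => M ε₁ ε₂ p ξ₀ C D x s i j)
      ((vecMulVec (waveCol p ξ₀ 2 x t) (waveRow p ξ₀ 0 x t)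
        - vecMulVec (waveCol p ξ₀ 1 x t) (waveRow p ξ₀ 1 x t)
        + vecMulVec (waveCol p ξ₀ 0 x t) (waveRow p ξ₀ 2 x t)) i j) t := by
  refine (((((hasDerivAt_phase_t p ξ₀ x t i).add
    (hasDerivAt_phase_t p ξ₀ x t j).star).cexp.sub_const _).sub_const _).const_mul
      _).congr_deriv ?_
  simp only [Matrix.add_apply, Matrix.sub_apply, vecMulVec_apply, waveCol, waveRow, Pi.add_apply,
    Complex.exp_add, RCLike.star_def, map_pow]
  field_simp [hp i j]
  ring

theorem diagonal_mul_M_add (ε₁ ε₂ : ℝ) (p ξ₀ C D : Fin N → ℂ)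
    (hp : ∀ i j, p i + conj (p j) ≠ 0) (x t : ℝ) :
    diagonal p * M ε₁ ε₂ p ξ₀ C D x t + M ε₁ ε₂ p ξ₀ C D x t * diagonal (star p) =
      vecMulVec (waveCol p ξ₀ 0 x t) (waveRow p ξ₀ 0 x t)
        - (ε₁ : ℂ) • vecMulVec (star C) C - (ε₂ : ℂ) • vecMulVec (star D) D := by
  ext i j
  simp only [Matrix.add_apply, Matrix.sub_apply, Matrix.smul_apply, diagonal_mul, mul_diagonal,
    M, of_apply, vecMulVec_apply, waveCol, waveRow, Complex.exp_add, Pi.star_apply,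
    RCLike.star_def, smul_eq_mul]
  field_simp [hp i j]

theorem isHermitian_M (ε₁ ε₂ : ℝ) (p ξ₀ C D : Fin N → ℂ) (x t : ℝ) :
    (M ε₁ ε₂ p ξ₀ C D x t).IsHermitian := by
  ext i j
  simp only [conjTranspose_apply, M, of_apply, RCLike.star_def, map_mul, map_sub, map_div₀,
    map_one, map_add, Complex.conj_conj, ← Complex.exp_conj, Complex.conj_ofReal]
  rw [add_comm (conj (p j)), add_comm (conj (phase p ξ₀ x t j))]
  ring

end CHirota

/-! ### Potentials and the coupled Hirota system. -/

namespace CHirota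

open Matrix

variable {N : ℕ}

section Potentials

variable (ε₁ ε₂ : ℝ) (p ξ₀ C D : Fin N → ℂ)

/-- The potential `cᵀ M⁻¹ ∂ₓⁿΦ`. -/
noncomputable def colPot (c : Fin N → ℂ) (n : ℕ) (x t : ℝ) : ℂ :=
  c ⬝ᵥ (M ε₁ ε₂ p ξ₀ C D x t)⁻¹ *ᵥ waveCol p ξ₀ n x t

/-- The potential `∂ₓᵐΦ^† M⁻¹ c^*`. -/
noncomputable def rowPot (c : Fin N → ℂ) (m : ℕ) (x t : ℝ) : ℂ :=
  waveRow p ξ₀ m x t ⬝ᵥ (M ε₁ ε₂ p ξ₀ C D x t)⁻¹ *ᵥ star c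

/-- The potential `∂ₓᵐΦ^† M⁻¹ ∂ₓⁿΦ`. -/
noncomputable def wavePot (m n : ℕ) (x t : ℝ) : ℂ :=
  waveRow p ξ₀ m x t ⬝ᵥ (M ε₁ ε₂ p ξ₀ C D x t)⁻¹ *ᵥ waveCol p ξ₀ n x t

variable {ε₁ ε₂ p ξ₀ C D}

theorem star_colPot (c : Fin N → ℂ) (n : ℕ) (x t : ℝ) :
    conj (colPot ε₁ ε₂ p ξ₀ C D c n x t) = rowPot ε₁ ε₂ p ξ₀ C D c n x t := by
  rw [colPot, rowPot, starRingEnd_apply, ← star_dotProduct_star, star_mulVec, star_waveCol,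
    (isHermitian_M ε₁ ε₂ p ξ₀ C D x t).inv.eq, dotProduct_mulVec, dotProduct_comm]

/-- Multiply the Sylvester equation by `M⁻¹` on both sides and pair with the waves; each rank-one
term splits into a product. -/
theorem wavePot_succ (hp : ∀ i j, p i + conj (p j) ≠ 0) {x t : ℝ}
    (hf : f ε₁ ε₂ p ξ₀ C D x t ≠ 0) (m n : ℕ) :
    wavePot ε₁ ε₂ p ξ₀ C D m (n + 1) x t + wavePot ε₁ ε₂ p ξ₀ C D (m + 1) n x t =
      wavePot ε₁ ε₂ p ξ₀ C D m 0 x t * wavePot ε₁ ε₂ p ξ₀ C D 0 n x t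
        - (ε₁ * rowPot ε₁ ε₂ p ξ₀ C D C m x t * colPot ε₁ ε₂ p ξ₀ C D C n x t
          + ε₂ * rowPot ε₁ ε₂ p ξ₀ C D D m x t * colPot ε₁ ε₂ p ξ₀ C D D n x t) := by
  have hu : IsUnit (M ε₁ ε₂ p ξ₀ C D x t).det := isUnit_iff_ne_zero.2 hf
  have h := congrArg (fun A => (M ε₁ ε₂ p ξ₀ C D x t)⁻¹ * A * (M ε₁ ε₂ p ξ₀ C D x t)⁻¹)
    (diagonal_mul_M_add ε₁ ε₂ p ξ₀ C D hp x t)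
  have h1 := congrArg (fun A => waveRow p ξ₀ m x t ⬝ᵥ A *ᵥ waveCol p ξ₀ n x t) h
  simp only [Matrix.mul_add, Matrix.add_mul, Matrix.mul_sub, Matrix.sub_mul, add_mulVec,
    sub_mulVec, dotProduct_add, dotProduct_sub, Matrix.mul_smul, Matrix.smul_mul, smul_mulVec,
    dotProduct_smul, dotProduct_mul_vecMulVec_mul_mulVec, smul_eq_mul] at h1
  rw [nonsing_inv_mul_cancel_left _ _ hu, ← Matrix.mul_assoc,
    mul_nonsing_inv_cancel_right _ _ hu] at h1
  simp only [wavePot, rowPot, colPot, waveCol_succ, waveRow_succ]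
  rw [mulVec_mulVec, ← dotProduct_mulVec, mulVec_mulVec, h1]
  ring

theorem hasDerivAt_colPot_x (hp : ∀ i j, p i + conj (p j) ≠ 0) {x t : ℝ}
    (hf : f ε₁ ε₂ p ξ₀ C D x t ≠ 0) (c : Fin N → ℂ) (n : ℕ) :
    HasDerivAt (fun y => colPot ε₁ ε₂ p ξ₀ C D c n y t)
      (colPot ε₁ ε₂ p ξ₀ C D c (n + 1) x t
        - colPot ε₁ ε₂ p ξ₀ C D c 0 x t * wavePot ε₁ ε₂ p ξ₀ C D 0 n x t) x := by
  refine (hasDerivAt_dotProduct_inv_mulVec (hasDerivAt_M_x ε₁ ε₂ p ξ₀ C D hp x t) hf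
    (fun i => hasDerivAt_const x (c i)) (hasDerivAt_waveCol_x p ξ₀ n x t)).congr_deriv ?_
  rw [dotProduct_mul_vecMulVec_mul_mulVec]
  change (0 : Fin N → ℂ) ⬝ᵥ _ + _ - _ = _
  rw [zero_dotProduct, zero_add]
  rfl

theorem hasDerivAt_rowPot_x (hp : ∀ i j, p i + conj (p j) ≠ 0) {x t : ℝ}
    (hf : f ε₁ ε₂ p ξ₀ C D x t ≠ 0) (c : Fin N → ℂ) (m : ℕ) :
    HasDerivAt (fun y => rowPot ε₁ ε₂ p ξ₀ C D c m y t)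
      (rowPot ε₁ ε₂ p ξ₀ C D c (m + 1) x t
        - wavePot ε₁ ε₂ p ξ₀ C D m 0 x t * rowPot ε₁ ε₂ p ξ₀ C D c 0 x t) x := by
  refine (hasDerivAt_dotProduct_inv_mulVec (hasDerivAt_M_x ε₁ ε₂ p ξ₀ C D hp x t) hf
    (hasDerivAt_waveRow_x p ξ₀ m x t) (fun i => hasDerivAt_const x (star c i))).congr_deriv ?_
  rw [dotProduct_mul_vecMulVec_mul_mulVec]
  change _ + _ ⬝ᵥ _ *ᵥ (0 : Fin N → ℂ) - _ = _
  rw [mulVec_zero, dotProduct_zero, add_zero]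
  rfl

/-- The product rule gives exactly the combination that `wavePot_succ` evaluates, so only row and
column potentials remain. -/
theorem hasDerivAt_wavePot_x (hp : ∀ i j, p i + conj (p j) ≠ 0) {x t : ℝ}
    (hf : f ε₁ ε₂ p ξ₀ C D x t ≠ 0) (m n : ℕ) :
    HasDerivAt (fun y => wavePot ε₁ ε₂ p ξ₀ C D m n y t)
      (-(ε₁ * rowPot ε₁ ε₂ p ξ₀ C D C m x t * colPot ε₁ ε₂ p ξ₀ C D C n x t
          + ε₂ * rowPot ε₁ ε₂ p ξ₀ C D D m x t * colPot ε₁ ε₂ p ξ₀ C D D n x t)) x := by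
  refine (hasDerivAt_dotProduct_inv_mulVec (hasDerivAt_M_x ε₁ ε₂ p ξ₀ C D hp x t) hf
    (hasDerivAt_waveRow_x p ξ₀ m x t) (hasDerivAt_waveCol_x p ξ₀ n x t)).congr_deriv ?_
  rw [dotProduct_mul_vecMulVec_mul_mulVec]
  have h := wavePot_succ hp hf m n
  simp only [wavePot] at h ⊢
  linear_combination h

theorem hasDerivAt_colPot_t (hp : ∀ i j, p i + conj (p j) ≠ 0) {x t : ℝ}
    (hf : f ε₁ ε₂ p ξ₀ C D x t ≠ 0) (c : Fin N → ℂ) (n : ℕ) :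
    HasDerivAt (fun s => colPot ε₁ ε₂ p ξ₀ C D c n x s)
      (colPot ε₁ ε₂ p ξ₀ C D c (n + 3) x t
        - colPot ε₁ ε₂ p ξ₀ C D c 2 x t * wavePot ε₁ ε₂ p ξ₀ C D 0 n x t
        + colPot ε₁ ε₂ p ξ₀ C D c 1 x t * wavePot ε₁ ε₂ p ξ₀ C D 1 n x t
        - colPot ε₁ ε₂ p ξ₀ C D c 0 x t * wavePot ε₁ ε₂ p ξ₀ C D 2 n x t) t := by
  refine (hasDerivAt_dotProduct_inv_mulVec (hasDerivAt_M_t ε₁ ε₂ p ξ₀ C D hp x t) hf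
    (fun i => hasDerivAt_const t (c i)) (hasDerivAt_waveCol_t p ξ₀ n x t)).congr_deriv ?_
  change (0 : Fin N → ℂ) ⬝ᵥ _ + _ - _ = _
  rw [zero_dotProduct, zero_add]
  simp only [Matrix.mul_add, Matrix.add_mul, Matrix.mul_sub, Matrix.sub_mul, add_mulVec,
    sub_mulVec, dotProduct_add, dotProduct_sub, dotProduct_mul_vecMulVec_mul_mulVec, colPot,
    wavePot]
  ring

theorem iteratedDeriv_three_eq {F F₁ F₂ : ℝ → ℂ} {d : ℂ} {x : ℝ}
    (h₀ : ∀ᶠ y in nhds x, HasDerivAt F (F₁ y) y) (h₁ : ∀ᶠ y in nhds x, HasDerivAt F₁ (F₂ y) y)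
    (h₂ : HasDerivAt F₂ d x) : iteratedDeriv 3 F x = d := by
  have e₁ : deriv F =ᶠ[nhds x] F₁ := h₀.mono fun y hy => hy.deriv
  have e₂ : deriv F₁ =ᶠ[nhds x] F₂ := h₁.mono fun y hy => hy.deriv
  have : iteratedDeriv 3 F = deriv (deriv (deriv F)) := by
    simp [iteratedDeriv_succ]
  rw [this, (e₁.deriv.trans e₂).deriv_eq, h₂.deriv]

theorem eventually_f_ne_zero_x {x t : ℝ} (hf : f ε₁ ε₂ p ξ₀ C D x t ≠ 0) :
    ∀ᶠ y in nhds x, f ε₁ ε₂ p ξ₀ C D y t ≠ 0 :=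
  (Continuous.prodMk_left t).continuousAt.eventually
    ((contDiff_f ε₁ ε₂ p ξ₀ C D).continuous.continuousAt.eventually_ne
      (show f ε₁ ε₂ p ξ₀ C D (x, t).1 (x, t).2 ≠ 0 from hf))

theorem eventually_f_ne_zero_t {x t : ℝ} (hf : f ε₁ ε₂ p ξ₀ C D x t ≠ 0) :
    ∀ᶠ s in nhds t, f ε₁ ε₂ p ξ₀ C D x s ≠ 0 :=
  (Continuous.prodMk_right x).continuousAt.eventually
    ((contDiff_f ε₁ ε₂ p ξ₀ C D).continuous.continuousAt.eventually_ne
      (show f ε₁ ε₂ p ξ₀ C D (x, t).1 (x, t).2 ≠ 0 from hf))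

/-- For every constant vector `c` the function `cᵀ M⁻¹ Φ` solves the linear equation whose
coefficients are given by the potentials of `C` and `D`. -/
theorem deriv_colPot_t (hp : ∀ i j, p i + conj (p j) ≠ 0) {x t : ℝ}
    (hf : f ε₁ ε₂ p ξ₀ C D x t ≠ 0) (c : Fin N → ℂ) :
    deriv (fun s => colPot ε₁ ε₂ p ξ₀ C D c 0 x s) t =
      iteratedDeriv 3 (fun y => colPot ε₁ ε₂ p ξ₀ C D c 0 y t) x
        - 3 * (ε₁ * (conj (colPot ε₁ ε₂ p ξ₀ C D C 0 x t) * colPot ε₁ ε₂ p ξ₀ C D C 0 x t)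
            + ε₂ * (conj (colPot ε₁ ε₂ p ξ₀ C D D 0 x t) * colPot ε₁ ε₂ p ξ₀ C D D 0 x t))
          * deriv (fun y => colPot ε₁ ε₂ p ξ₀ C D c 0 y t) x
        - 3 * colPot ε₁ ε₂ p ξ₀ C D c 0 x t
          * (ε₁ * conj (colPot ε₁ ε₂ p ξ₀ C D C 0 x t)
              * deriv (fun y => colPot ε₁ ε₂ p ξ₀ C D C 0 y t) x
            + ε₂ * conj (colPot ε₁ ε₂ p ξ₀ C D D 0 x t)
              * deriv (fun y => colPot ε₁ ε₂ p ξ₀ C D D 0 y t) x) := by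
  have hT (c : Fin N → ℂ) (n : ℕ) (y : ℝ) (hy : f ε₁ ε₂ p ξ₀ C D y t ≠ 0) :=
    hasDerivAt_colPot_x hp hy c n
  have hR (c : Fin N → ℂ) (n : ℕ) (y : ℝ) (hy : f ε₁ ε₂ p ξ₀ C D y t ≠ 0) :=
    hasDerivAt_rowPot_x hp hy c n
  have hS (m n : ℕ) (y : ℝ) (hy : f ε₁ ε₂ p ξ₀ C D y t ≠ 0) :=
    hasDerivAt_wavePot_x hp hy m n
  have hn := eventually_f_ne_zero_x hf
  -- Minus the `x`-derivative of `wavePot 0 0`, differentiated once more for the third derivative.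
  have hE (y : ℝ) (hy : f ε₁ ε₂ p ξ₀ C D y t ≠ 0) :=
    (((hR C 0 y hy).const_mul (ε₁ : ℂ)).mul (hT C 0 y hy)).add
      (((hR D 0 y hy).const_mul (ε₂ : ℂ)).mul (hT D 0 y hy))
  have d₁ (y : ℝ) (hy : f ε₁ ε₂ p ξ₀ C D y t ≠ 0) :=
    (hT c 1 y hy).sub ((hT c 0 y hy).mul (hS 0 0 y hy))
  have d₂ := ((hT c 2 x hf).sub ((hT c 0 x hf).mul (hS 0 1 x hf))).sub
    ((((hT c 1 x hf).sub ((hT c 0 x hf).mul (hS 0 0 x hf))).mul (hS 0 0 x hf)).add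
      ((hT c 0 x hf).mul (hE x hf).neg))
  rw [iteratedDeriv_three_eq (hn.mono (hT c 0)) (hn.mono d₁) d₂, (hT c 0 x hf).deriv,
    (hT C 0 x hf).deriv, (hT D 0 x hf).deriv, (hasDerivAt_colPot_t hp hf c 0).deriv,
    star_colPot, star_colPot]
  simp only [Pi.add_apply, Pi.sub_apply, Pi.mul_apply, Pi.neg_apply, Nat.reduceAdd]
  have r₀ := wavePot_succ hp hf 0 0
  have r₁ := wavePot_succ hp hf 0 1
  have r₂ := wavePot_succ hp hf 1 0
  simp only [Nat.reduceAdd] at r₀ r₁ r₂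
  -- The difference `r₁ - r₂` eliminates `wavePot 1 1`, leaving the relation between `wavePot 0 2`
  -- and `wavePot 2 0`.
  linear_combination (colPot ε₁ ε₂ p ξ₀ C D c 1 x t
      - colPot ε₁ ε₂ p ξ₀ C D c 0 x t * wavePot ε₁ ε₂ p ξ₀ C D 0 0 x t) * r₀
    + colPot ε₁ ε₂ p ξ₀ C D c 0 x t * (r₁ - r₂)

theorem u₁_eq_colPot {x t : ℝ} (hf : f ε₁ ε₂ p ξ₀ C D x t ≠ 0) :
    u₁ ε₁ ε₂ p ξ₀ C D x t = colPot ε₁ ε₂ p ξ₀ C D C 0 x t := by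
  rw [u₁, g₁, borderedDet_eq _ _ _ hf, ← waveCol_zero]
  exact mul_div_cancel_left₀ _ hf

theorem u₂_eq_colPot {x t : ℝ} (hf : f ε₁ ε₂ p ξ₀ C D x t ≠ 0) :
    u₂ ε₁ ε₂ p ξ₀ C D x t = colPot ε₁ ε₂ p ξ₀ C D D 0 x t := by
  rw [u₂, g₂, borderedDet_eq _ _ _ hf, ← waveCol_zero]
  exact mul_div_cancel_left₀ _ hf

theorem isSolutionOn (hp : ∀ i j, p i + conj (p j) ≠ 0) :
    IsSolutionOn ε₁ ε₂ (u₁ ε₁ ε₂ p ξ₀ C D) (u₂ ε₁ ε₂ p ξ₀ C D)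
      {z : ℝ × ℝ | f ε₁ ε₂ p ξ₀ C D z.1 z.2 ≠ 0} := by
  have hcd := contDiff_f ε₁ ε₂ p ξ₀ C D
  have hsq (z : ℂ) : ((‖z‖ ^ 2 : ℝ) : ℂ) = conj z * z := by
    rw [Complex.conj_mul', Complex.ofReal_pow]
  have e₁x {x t : ℝ} (hf : f ε₁ ε₂ p ξ₀ C D x t ≠ 0) : (fun y => u₁ ε₁ ε₂ p ξ₀ C D y t)
      =ᶠ[nhds x] fun y => colPot ε₁ ε₂ p ξ₀ C D C 0 y t :=
    (eventually_f_ne_zero_x hf).mono fun y hy => u₁_eq_colPot hy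
  have e₂x {x t : ℝ} (hf : f ε₁ ε₂ p ξ₀ C D x t ≠ 0) : (fun y => u₂ ε₁ ε₂ p ξ₀ C D y t)
      =ᶠ[nhds x] fun y => colPot ε₁ ε₂ p ξ₀ C D D 0 y t :=
    (eventually_f_ne_zero_x hf).mono fun y hy => u₂_eq_colPot hy
  have e₁t {x t : ℝ} (hf : f ε₁ ε₂ p ξ₀ C D x t ≠ 0) : (fun s => u₁ ε₁ ε₂ p ξ₀ C D x s)
      =ᶠ[nhds t] fun s => colPot ε₁ ε₂ p ξ₀ C D C 0 x s :=
    (eventually_f_ne_zero_t hf).mono fun s hs => u₁_eq_colPot hs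
  have e₂t {x t : ℝ} (hf : f ε₁ ε₂ p ξ₀ C D x t ≠ 0) : (fun s => u₂ ε₁ ε₂ p ξ₀ C D x s)
      =ᶠ[nhds t] fun s => colPot ε₁ ε₂ p ξ₀ C D D 0 x s :=
    (eventually_f_ne_zero_t hf).mono fun s hs => u₂_eq_colPot hs
  refine ⟨isOpen_ne_fun hcd.continuous continuous_const, ?_, ?_, fun x t hf => ?_,
    fun x t hf => ?_⟩
  · simp only [u₁, g₁, div_eq_mul_inv]
    exact (contDiff_borderedDet ε₁ ε₂ p ξ₀ C D C).contDiffOn.mul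
      (hcd.contDiffOn.inv fun z hz => hz)
  · simp only [u₂, g₂, div_eq_mul_inv]
    exact (contDiff_borderedDet ε₁ ε₂ p ξ₀ C D D).contDiffOn.mul
      (hcd.contDiffOn.inv fun z hz => hz)
  · rw [(e₁t hf).deriv_eq, (e₁x hf).iteratedDeriv_eq, (e₁x hf).deriv_eq, (e₂x hf).deriv_eq,
      hsq, hsq, u₁_eq_colPot hf, u₂_eq_colPot hf]
    exact deriv_colPot_t hp hf C
  · rw [(e₂t hf).deriv_eq, (e₂x hf).iteratedDeriv_eq, (e₁x hf).deriv_eq, (e₂x hf).deriv_eq,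
      hsq, hsq, u₁_eq_colPot hf, u₂_eq_colPot hf]
    exact deriv_colPot_t hp hf D

end Potentials

end CHirota

/-! ### Behaviour as `x → ±∞`. -/

namespace CHirota

open Matrix Filter

open scoped Topology

theorem eq_zero_of_submatrix_det_ne_zero {n : Type*} [Fintype n] [DecidableEq n] (S : n → Prop)
    [DecidablePred S] (A : Matrix n n ℂ)
    (hA : (A.submatrix (fun i : {i // S i} => i.1) (fun i : {i // S i} => i.1)).det ≠ 0)
    {y : n → ℂ} (hy : ∀ i, S i → ∑ j, (if S j then A i j * y j else 0) = 0) :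
    ∀ j, S j → y j = 0 := by
  have h : (A.submatrix (fun i : {i // S i} => i.1) (fun i : {i // S i} => i.1)) *ᵥ
      (fun j : {i // S i} => y j.1) = 0 := by
    ext i
    rw [Pi.zero_apply, ← hy i.1 i.2, ← Finset.sum_filter,
      Finset.sum_subtype (Finset.univ.filter S) (p := S) (by simp)]
    rfl
  exact fun j hj => congrFun (eq_zero_of_mulVec_eq_zero hA h) ⟨j, hj⟩

variable {N : ℕ} {ε₁ ε₂ : ℝ} {p ξ₀ C D : Fin N → ℂ}

theorem M_apply (x t : ℝ) (i j : Fin N) :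
    M ε₁ ε₂ p ξ₀ C D x t i j =
      1 / (p i + conj (p j)) * (Phi p ξ₀ x t i * conj (Phi p ξ₀ x t j))
        + K ε₁ ε₂ p C D i j := by
  simp only [M, K, Phi, of_apply, Complex.exp_add, ← Complex.exp_conj]
  ring

/-- `diag(b) A diag(b^*)` is invertible together with `A`, and the bilinear forms of the inverses
agree after rescaling the vectors. -/
theorem dotProduct_inv_mulVec_rescale (A : Matrix (Fin N) (Fin N) ℂ) {b : Fin N → ℂ}
    (hb : ∀ i, b i ≠ 0) (c e : Fin N → ℂ) :
    c ⬝ᵥ A⁻¹ *ᵥ e =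
      (fun i => c i * conj (b i)) ⬝ᵥ (diagonal b * A * diagonal (star b))⁻¹ *ᵥ
        (fun i => b i * e i) := by
  have h₁ : IsUnit (diagonal b).det := by
    rw [det_diagonal]
    exact isUnit_iff_ne_zero.2 (Finset.prod_ne_zero_iff.2 fun i _ => hb i)
  have h₂ : IsUnit (diagonal (star b)).det := by
    rw [det_diagonal]
    exact isUnit_iff_ne_zero.2 (Finset.prod_ne_zero_iff.2 fun i _ => star_ne_zero.2 (hb i))
  have hc : (fun i => c i * conj (b i)) = c ᵥ* diagonal (star b) := by
    ext i
    simp [vecMul_diagonal]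
  have he : (fun i => b i * e i) = diagonal b *ᵥ e := by
    ext i
    simp [mulVec_diagonal]
  have h : diagonal (star b) * (diagonal b * A * diagonal (star b))⁻¹ * diagonal b = A⁻¹ := by
    rw [Matrix.mul_inv_rev, Matrix.mul_inv_rev, mul_nonsing_inv_cancel_left _ _ h₂,
      nonsing_inv_mul_cancel_right _ _ h₁]
  rw [hc, he, ← dotProduct_mulVec, mulVec_mulVec, mulVec_mulVec, h]

variable (ε₁ ε₂ p C D) in
/-- The limit of the rescaled matrix `M`: a Cauchy block over `S` and a block of `K` over `S'`. -/
noncomputable def limitMatrix (S S' : Fin N → Prop) [DecidablePred S] [DecidablePred S'] :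
    Matrix (Fin N) (Fin N) ℂ :=
  of fun i j => 1 / (p i + conj (p j)) * ((if S i then 1 else 0) * (if S j then 1 else 0))
    + K ε₁ ε₂ p C D i j * ((if S' i then 1 else 0) * (if S' j then 1 else 0))

section Limit

variable {S S' : Fin N → Prop} [DecidablePred S] [DecidablePred S']

theorem eq_zero_of_limitMatrix_mulVec (hS : ∀ i, S' i ↔ ¬S i)
    (hK : ((K ε₁ ε₂ p C D).submatrix (fun i : {i // S' i} => i.1)
      (fun i : {i // S' i} => i.1)).det ≠ 0)
    {y : Fin N → ℂ} (hy : ∀ i, S' i → (limitMatrix ε₁ ε₂ p C D S S' *ᵥ y) i = 0) :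
    ∀ j, S' j → y j = 0 := by
  refine eq_zero_of_submatrix_det_ne_zero S' _ hK fun i hi => ?_
  refine Eq.trans (Finset.sum_congr rfl fun j _ => ?_) (hy i hi)
  simp [limitMatrix, hi, (hS i).1 hi]

theorem det_limitMatrix_ne_zero (hp : ∀ i j, p i + conj (p j) ≠ 0)
    (hinj : Function.Injective p) (hS : ∀ i, S' i ↔ ¬S i)
    (hK : ((K ε₁ ε₂ p C D).submatrix (fun i : {i // S' i} => i.1)
      (fun i : {i // S' i} => i.1)).det ≠ 0) :
    (limitMatrix ε₁ ε₂ p C D S S').det ≠ 0 := by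
  intro h0
  obtain ⟨y, hy0, hy⟩ := exists_mulVec_eq_zero_iff.2 h0
  have h' := eq_zero_of_limitMatrix_mulVec hS hK fun i _ => congrFun hy i
  have hcauchy : ((of fun i j => 1 / (p i + conj (p j))).submatrix (fun i : {i // S i} => i.1)
      (fun i : {i // S i} => i.1)).det ≠ 0 :=
    det_cauchy_ne_zero (q := fun i : {i // S i} => p i.1) (r := fun i : {i // S i} => conj (p i.1))
      (hinj.comp Subtype.val_injective)
      ((RingHom.injective _).comp (hinj.comp Subtype.val_injective)) fun i j => hp i.1 j.1
  have h := eq_zero_of_submatrix_det_ne_zero S _ hcauchy (y := y) fun i hi => by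
    refine Eq.trans (Finset.sum_congr rfl fun j _ => ?_) (congrFun hy i)
    have hi' : ¬S' i := fun h => (hS i).1 h hi
    simp [limitMatrix, hi, hi']
  refine hy0 (funext fun j => ?_)
  by_cases hj : S j
  · exact h j hj
  · exact h' j ((hS j).2 hj)

/-- Block diagonality keeps the solution for the indicator of `S` supported on `S`, while the left
vector lives on `S'`. -/
theorem dotProduct_limitMatrix_inv_mulVec (hp : ∀ i j, p i + conj (p j) ≠ 0)
    (hinj : Function.Injective p) (hS : ∀ i, S' i ↔ ¬S i)
    (hK : ((K ε₁ ε₂ p C D).submatrix (fun i : {i // S' i} => i.1)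
      (fun i : {i // S' i} => i.1)).det ≠ 0) (c : Fin N → ℂ) :
    (fun i => c i * (if S' i then 1 else 0)) ⬝ᵥ (limitMatrix ε₁ ε₂ p C D S S')⁻¹ *ᵥ
      (fun i => if S i then 1 else 0) = 0 := by
  have hdet := det_limitMatrix_ne_zero hp hinj hS hK
  have h := eq_zero_of_limitMatrix_mulVec hS hK
    (y := (limitMatrix ε₁ ε₂ p C D S S')⁻¹ *ᵥ fun i => if S i then 1 else 0) fun i hi => by
      rw [mulVec_mulVec, mul_nonsing_inv _ (isUnit_iff_ne_zero.2 hdet), one_mulVec,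
        if_neg ((hS i).1 hi)]
  refine Finset.sum_eq_zero fun i _ => ?_
  by_cases hi : S' i
  · rw [h i hi, mul_zero]
  · simp [hi]

theorem tendsto_colPot_zero (hp : ∀ i j, p i + conj (p j) ≠ 0)
    (hinj : Function.Injective p) (hS : ∀ i, S' i ↔ ¬S i)
    (hK : ((K ε₁ ε₂ p C D).submatrix (fun i : {i // S' i} => i.1)
      (fun i : {i // S' i} => i.1)).det ≠ 0) {t : ℝ} {l : Filter ℝ}
    (hgrow : ∀ i, S i → Tendsto (fun x => (Phi p ξ₀ x t i)⁻¹) l (𝓝 0))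
    (hdecay : ∀ i, S' i → Tendsto (fun x => Phi p ξ₀ x t i) l (𝓝 0)) :
    (∀ᶠ x in l, f ε₁ ε₂ p ξ₀ C D x t ≠ 0) ∧
      ∀ c, Tendsto (fun x => colPot ε₁ ε₂ p ξ₀ C D c 0 x t) l (𝓝 0) := by
  have hne (x : ℝ) (i : Fin N) : Phi p ξ₀ x t i ≠ 0 := Complex.exp_ne_zero _
  -- Normalises the growing exponentials to `1`: `b` tends to the indicator of `S'` and `bΦ` to that
  -- of `S`.
  let b : ℝ → Fin N → ℂ := fun x i => if S i then (Phi p ξ₀ x t i)⁻¹ else 1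
  have hb0 (x : ℝ) (i : Fin N) : b x i ≠ 0 := by
    by_cases hi : S i
    · simpa [b, hi] using hne x i
    · simp [b, hi]
  have hb (i : Fin N) : Tendsto (fun x => b x i) l (𝓝 (if S' i then 1 else 0)) := by
    by_cases hi : S i
    · simpa [b, hi, hS] using hgrow i hi
    · simp [b, hi, hS, tendsto_const_nhds]
  have ha (i : Fin N) :
      Tendsto (fun x => b x i * Phi p ξ₀ x t i) l (𝓝 (if S i then 1 else 0)) := by
    by_cases hi : S i
    · simp [b, hi, hne, tendsto_const_nhds]
    · simpa [b, hi] using hdecay i ((hS i).2 hi)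
  have hconj {g : ℝ → ℂ} {P : Prop} [Decidable P] (hg : Tendsto g l (𝓝 (if P then 1 else 0))) :
      Tendsto (fun x => conj (g x)) l (𝓝 (if P then 1 else 0)) := by
    have := (Complex.continuous_conj.tendsto _).comp hg
    split_ifs at this ⊢ <;> simpa [Function.comp_def] using this
  let B : ℝ → Matrix (Fin N) (Fin N) ℂ := fun x =>
    diagonal (b x) * M ε₁ ε₂ p ξ₀ C D x t * diagonal (star (b x))
  have hB : Tendsto B l (𝓝 (limitMatrix ε₁ ε₂ p C D S S')) := by
    refine tendsto_pi_nhds.2 fun i => tendsto_pi_nhds.2 fun j => ?_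
    refine (((((ha i).mul (hconj (ha j))).const_mul (1 / (p i + conj (p j)))).add
      (((hb i).mul (hconj (hb j))).const_mul (K ε₁ ε₂ p C D i j)))).congr fun x => ?_
    simp only [B, diagonal_mul, mul_diagonal, M_apply, map_mul, Pi.star_apply, RCLike.star_def]
    ring
  have hdet := det_limitMatrix_ne_zero hp hinj hS hK
  have hBdet : Tendsto (fun x => (B x).det) l (𝓝 (limitMatrix ε₁ ε₂ p C D S S').det) :=
    (continuous_id.matrix_det.tendsto _).comp hB
  have hBinv : Tendsto (fun x => (B x)⁻¹) l (𝓝 (limitMatrix ε₁ ε₂ p C D S S')⁻¹) := by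
    simp only [inv_def, Ring.inverse_eq_inv']
    exact (hBdet.inv₀ hdet).smul ((continuous_id.matrix_adjugate.tendsto _).comp hB)
  refine ⟨(hBdet.eventually_ne hdet).mono fun x hx hf => hx ?_, fun c => ?_⟩
  · simp only [B, det_mul]
    rw [show (M ε₁ ε₂ p ξ₀ C D x t).det = 0 from hf, mul_zero, zero_mul]
  · rw [← dotProduct_limitMatrix_inv_mulVec hp hinj hS hK c]
    refine Tendsto.congr (fun x => (dotProduct_inv_mulVec_rescale _ (hb0 x) c _).symm) ?_
    simp only [dotProduct, mulVec, waveCol_zero]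
    refine tendsto_finsetSum _ fun i _ => ((hconj (hb i)).const_mul (c i)).mul
      (tendsto_finsetSum _ fun j _ => Tendsto.mul ?_ (ha j))
    exact tendsto_pi_nhds.1 (tendsto_pi_nhds.1 hBinv i) j

end Limit

theorem phase_re (x t : ℝ) (i : Fin N) :
    (phase p ξ₀ x t i).re = (p i).re * x + (phase p ξ₀ 0 t i).re := by
  simp [phase]
  ring

theorem zeroBoundaryAt (hp : ∀ i j, p i + conj (p j) ≠ 0) (h : Nondegenerate ε₁ ε₂ p C D)
    (t : ℝ) : ZeroBoundaryAt ε₁ ε₂ p ξ₀ C D t := by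
  classical
  obtain ⟨hinj, hpos, hneg⟩ := h
  -- The case `i = j` of `hp` excludes `Re p_i = 0`, so every exponential grows or decays.
  have hre (i : Fin N) : (p i).re ≠ 0 := fun h => hp i i (by rw [Complex.add_conj, h]; simp)
  have hdecay {l : Filter ℝ} {i : Fin N} (hl : Tendsto (fun x => (p i).re * x) l atBot) :
      Tendsto (fun x => Phi p ξ₀ x t i) l (𝓝 0) := by
    refine Complex.tendsto_exp_nhds_zero_iff.2 ?_
    rw [funext fun x => phase_re x t i]
    exact tendsto_atBot_add_const_right l _ hl
  have hgrow {l : Filter ℝ} {i : Fin N} (hl : Tendsto (fun x => (p i).re * x) l atTop) :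
      Tendsto (fun x => (Phi p ξ₀ x t i)⁻¹) l (𝓝 0) := by
    simp only [Phi, ← Complex.exp_neg]
    refine Complex.tendsto_exp_nhds_zero_iff.2 ?_
    simp only [Complex.neg_re]
    rw [funext fun x => congrArg Neg.neg (phase_re x t i)]
    exact tendsto_neg_atTop_atBot.comp (tendsto_atTop_add_const_right l _ hl)
  have key {l : Filter ℝ} (H : (∀ᶠ x in l, f ε₁ ε₂ p ξ₀ C D x t ≠ 0) ∧
      ∀ c, Tendsto (fun x => colPot ε₁ ε₂ p ξ₀ C D c 0 x t) l (𝓝 0)) :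
      (∀ᶠ x in l, f ε₁ ε₂ p ξ₀ C D x t ≠ 0) ∧
        Tendsto (fun x => u₁ ε₁ ε₂ p ξ₀ C D x t) l (𝓝 0) ∧
        Tendsto (fun x => u₂ ε₁ ε₂ p ξ₀ C D x t) l (𝓝 0) :=
    ⟨H.1, (H.2 C).congr' (H.1.mono fun x hx => (u₁_eq_colPot hx).symm),
      (H.2 D).congr' (H.1.mono fun x hx => (u₂_eq_colPot hx).symm)⟩
  -- At `+∞` the decaying indices have `Re p_i < 0`, at `-∞` they have `Re p_i > 0`; each end uses
  -- one of the two minors.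
  rintro l (rfl | rfl)
  · exact key (tendsto_colPot_zero (S := fun i => 0 < (p i).re) (S' := fun i => (p i).re < 0)
      hp hinj (fun i => by rw [not_lt]; exact ⟨le_of_lt, fun h => lt_of_le_of_ne h (hre i)⟩) hneg
      (fun i hi => hgrow (tendsto_id.const_mul_atTop hi))
      (fun i hi => hdecay (tendsto_id.const_mul_atTop_of_neg hi)))
  · exact key (tendsto_colPot_zero (S := fun i => (p i).re < 0) (S' := fun i => 0 < (p i).re)
      hp hinj (fun i => by rw [not_lt]; exact ⟨le_of_lt, fun h => lt_of_le_of_ne h (hre i).symm⟩)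
      hpos (fun i hi => hgrow (tendsto_id.const_mul_atBot_of_neg hi))
      (fun i hi => hdecay (tendsto_id.const_mul_atBot hi)))

end CHirota

theorem theorem2p1 (N : ℕ) (ε₁ ε₂ : ℝ) (p ξ₀ C D : Fin N → ℂ)
    (hp : ∀ i j, p i + (starRingEnd ℂ) (p j) ≠ 0) :
    CHirota.IsSolutionOn ε₁ ε₂
      (CHirota.u₁ ε₁ ε₂ p ξ₀ C D) (CHirota.u₂ ε₁ ε₂ p ξ₀ C D)
      {z : ℝ × ℝ | CHirota.f ε₁ ε₂ p ξ₀ C D z.1 z.2 ≠ 0} ∧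
    (CHirota.Nondegenerate ε₁ ε₂ p C D →
      ∀ t : ℝ, CHirota.ZeroBoundaryAt ε₁ ε₂ p ξ₀ C D t) :=
  ⟨CHirota.isSolutionOn hp, fun h t => CHirota.zeroBoundaryAt hp h t⟩
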